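/- View $SL_n(\mathbb C)$ as a closed complex submanifold of the space of complex $n\times n$ matrices. A subset is called discrete if it is closed and its induced topology is discrete. An infinite discrete subset $D\subset SL_n(\mathbb C)$ is called (weakly) tame if for every exhaustion function $\rho:SL_n(\mathbb C)\to[0,\infty)$ (that is, $\rho$ is continuous and all sublevel sets $\{\rho\le c\}$ are compact) and every map $\zeta:D\to[0,\infty)$ there exists a biholomorphic self-map $\phi$ of the complex manifold $SL_n(\mathbb C)$ such that $\rho(\phi(x))\ge\zeta(x)$ for all $x\in D$. Theorem. Every infinite discrete subset $D$ of $SL_n(\mathbb C)$ is the union of $n$ (not necessarily disjoint or distinct) tame discrete subsets. More precisely, let $\pi_k(x)\in\mathbb C^n$ denote the $k$-th column of $x$, let $\|\cdot\|$ be the Euclidean norm, and put $$D_k=\{x\in D:\ \|\pi_k(x)\|\ge\|\pi_j(x)\|\ \text{for all } j\}\qquad(1\le k\le n).$$ Then there are tame discrete subsets $T_1,\dots,T_n$ of $SL_n(\mathbb C)$ with $D=T_1\cup\dots\cup T_n$, such that $D_k\subseteq T_k$ for every $k$, and $T_k=D_k$ whenever $D_k$ is infinite. -/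

import Mathlib

/-- A discrete subset of a space: closed, with discrete induced topology
(so it has no accumulation point in the ambient space). -/
def IsDiscreteSubset {X : Type*} [TopologicalSpace X] (D : Set X) : Prop :=
  IsClosed D ∧ IsDiscrete D

/-- An exhaustion function: continuous, nonnegative, with compact sublevel sets. -/
def IsExhaustion {X : Type*} [TopologicalSpace X] (ρ : X → ℝ) : Prop :=
  Continuous ρ ∧ (∀ x, 0 ≤ ρ x) ∧ ∀ c : ℝ, IsCompact {x | ρ x ≤ c}

/-- A self-map of `SL n ℂ`, a closed complex submanifold of the vector space of all matrices,
is holomorphic if near every point it is the restriction of a holomorphic map defined on an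
open set of matrices. -/
def IsHolomorphicSL {n : ℕ}
    (f : Matrix.SpecialLinearGroup (Fin n) ℂ → Matrix.SpecialLinearGroup (Fin n) ℂ) : Prop :=
  ∀ A : Matrix.SpecialLinearGroup (Fin n) ℂ,
    ∃ (U : Set (Matrix (Fin n) (Fin n) ℂ))
      (F : Matrix (Fin n) (Fin n) ℂ → Matrix (Fin n) (Fin n) ℂ),
      IsOpen U ∧ A.1 ∈ U ∧ DifferentiableOn ℂ F U ∧
        ∀ B : Matrix.SpecialLinearGroup (Fin n) ℂ, B.1 ∈ U → F B.1 = (f B).1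

/-- An automorphism of the complex manifold `SL n ℂ` (not of the group): a biholomorphic
self-map. -/
def IsHolomorphicAut {n : ℕ}
    (φ : Matrix.SpecialLinearGroup (Fin n) ℂ ≃ Matrix.SpecialLinearGroup (Fin n) ℂ) : Prop :=
  IsHolomorphicSL φ ∧ IsHolomorphicSL φ.symm

/-- (Weakly) tame subsets of the complex manifold `SL n ℂ`. -/
def IsTame {n : ℕ} (D : Set (Matrix.SpecialLinearGroup (Fin n) ℂ)) : Prop :=
  D.Infinite ∧ IsDiscreteSubset D ∧
    ∀ ρ : Matrix.SpecialLinearGroup (Fin n) ℂ → ℝ, IsExhaustion ρ →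
      ∀ ζ : D → ℝ, (∀ x, 0 ≤ ζ x) →
        ∃ φ : Matrix.SpecialLinearGroup (Fin n) ℂ ≃ Matrix.SpecialLinearGroup (Fin n) ℂ,
          IsHolomorphicAut φ ∧ ∀ x : D, ζ x ≤ ρ (φ x)

/-- The Euclidean norm of the `k`-th column of a matrix in `SL n ℂ`. -/
noncomputable def columnNorm {n : ℕ} (k : Fin n) (A : Matrix.SpecialLinearGroup (Fin n) ℂ) : ℝ :=
  ‖(WithLp.toLp 2 (fun i => A.1 i k) : EuclideanSpace ℂ (Fin n))‖

/-- The points of `D` whose `k`-th column has the largest norm among all columns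
(a point with several columns of maximal norm lies in several pieces). -/
def columnPiece {n : ℕ} (D : Set (Matrix.SpecialLinearGroup (Fin n) ℂ)) (k : Fin n) :
    Set (Matrix.SpecialLinearGroup (Fin n) ℂ) :=
  {A ∈ D | ∀ j, columnNorm j A ≤ columnNorm k A}

/-! A shear adds `f (column k A)` times column `k` to column `j`. It fixes column `k`, so replacing
`f` by `-f` inverts it, and it is holomorphic for entire `f`. If the norm of column `k` is proper on
`T`, the columns `k` of points of `T` meet each ball in a finite set, with finite fibres, so
`exists_entire_large_on_discrete` gives `f` as large as desired on them. Column `k` never vanishes,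
so a large `f` makes an entry of column `j` large and the image leaves any prescribed compact set:
`T` is tame. On `columnPiece D k` column `k` dominates the others, which makes its norm proper.
Finite pieces are padded with an infinite one. -/

/-! ### Entire functions of prescribed growth -/

/-- In a complex inner product space every nonzero point `a` is a strict peak point, for an affine
function, of the closed ball of radius `‖a‖`. -/
theorem exists_peak_function {E : Type*} [NormedAddCommGroup E] [InnerProductSpace ℂ E]
    {a : E} {r : ℝ} (ha : a ≠ 0) (hr : r < ‖a‖) :
    ∃ p : E → ℂ, Differentiable ℂ p ∧ p a = 1 ∧ (∀ z, ‖z‖ ≤ ‖a‖ → z ≠ a → ‖p z‖ < 1) ∧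
      (∃ q < 1, 0 ≤ q ∧ ∀ z, ‖z‖ ≤ r → ‖p z‖ ≤ q) ∧ ∃ C, ∀ z, ‖fderiv ℂ p z‖ ≤ C := by
  have ha' : 0 < ‖a‖ := norm_pos_iff.2 ha
  have haC : (‖a‖ : ℂ) ≠ 0 := by exact_mod_cast ha'.ne'
  -- The summand `1 / 2` makes the peak strict: the linear function `2 • L` alone has modulus one at
  -- every unimodular multiple of `a`.
  let L : E →L[ℂ] ℂ := (1 / (2 * (‖a‖ : ℂ) ^ 2)) • innerSL ℂ a
  have hL : ∀ z, 1 / 2 + L z = inner ℂ a (a + z) / (2 * (‖a‖ : ℂ) ^ 2) := by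
    intro z
    simp only [L, smul_apply, innerSL_apply_apply, smul_eq_mul, inner_add_right,
      inner_self_eq_norm_sq_to_K]
    field_simp
    rfl
  have hle : ∀ z, ‖1 / 2 + L z‖ ≤ ‖a + z‖ / (2 * ‖a‖) := by
    intro z
    rw [hL, norm_div, div_le_div_iff₀ (by simpa using pow_pos ha' 2) (by positivity)]
    have := norm_inner_le_norm (𝕜 := ℂ) a (a + z)
    simp only [norm_mul, norm_pow, Complex.norm_real, norm_norm, RCLike.norm_ofNat]
    nlinarith [norm_nonneg (inner ℂ a (a + z))]
  refine ⟨fun z => 1 / 2 + L z, L.differentiable.const_add _, ?_, fun z hz hza => ?_,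
    ⟨(‖a‖ + max r 0) / (2 * ‖a‖), ?_, by positivity, fun z hz => (hle z).trans ?_⟩, ‖L‖,
    fun z => ?_⟩
  · simp only [hL, inner_add_right, inner_self_eq_norm_sq_to_K]
    rw [← two_mul]
    exact div_self (mul_ne_zero two_ne_zero (pow_ne_zero 2 haC))
  · refine (hle z).trans_lt ?_
    rw [div_lt_one (by positivity)]
    have h := parallelogram_law_with_norm ℂ a z
    have : 0 < ‖a - z‖ := norm_pos_iff.2 (sub_ne_zero.2 hza.symm)
    nlinarith [norm_nonneg z, norm_nonneg (a + z)]
  · rw [div_lt_one (by positivity)]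
    have := max_lt hr ha'
    linarith
  · gcongr
    exact (norm_add_le _ _).trans (by gcongr; exact hz.trans (le_max_left _ _))
  · rw [fderiv_const_add, L.fderiv]

open Finset Filter Topology in
/-- Given finitely many points outside a closed ball, a function can be made large at these points
by adding a holomorphic function which is small on the ball together with its derivative. -/
theorem exists_small_on_ball_large_on_finset {E : Type*} [NormedAddCommGroup E]
    [InnerProductSpace ℂ E] [DecidableEq E] {r : ℝ} (hr : 0 ≤ r) (S : E → ℂ) (F : Finset E)
    (hF : ∀ v ∈ F, r < ‖v‖) (M : E → ℝ) {ε : ℝ} (hε : 0 < ε) :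
    ∃ g : E → ℂ, Differentiable ℂ g ∧ (∀ z, ‖z‖ ≤ r → ‖g z‖ ≤ ε ∧ ‖fderiv ℂ g z‖ ≤ ε) ∧
      ∀ v ∈ F, M v ≤ ‖S v + g v‖ := by
  -- The new point has maximal norm, so high powers of its peak function are small at all earlier
  -- points; the spare `1` in `M v + 1` absorbs them.
  induction F using Finset.induction_on_max_value (fun v : E => ‖v‖) generalizing M ε with
  | empty => exact ⟨fun _ => 0, by fun_prop, fun z _ => by simp [hε.le], by simp⟩
  | insert a s has hmax ih =>
    obtain ⟨g, hg, hsmall, hlarge⟩ :=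
      ih (fun v hv => hF v (mem_insert_of_mem hv)) (fun v => M v + 1) (half_pos hε)
    have har : r < ‖a‖ := hF a (mem_insert_self _ _)
    obtain ⟨p, hp, hpa, hp1, ⟨q, hq1, hq0, hpq⟩, C, hC⟩ :=
      exists_peak_function (norm_pos_iff.1 (hr.trans_lt har)) har
    have hC0 : 0 ≤ C := (norm_nonneg _).trans (hC 0)
    obtain ⟨b, hb⟩ : ∃ b : ℂ, M a ≤ ‖S a + g a + b‖ :=
      ⟨(|M a| : ℝ) - (S a + g a), by simpa using le_abs_self (M a)⟩
    have h1 : ∀ᶠ N : ℕ in atTop, ‖b‖ * q ^ (N + 1) ≤ ε / 2 := by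
      have : Tendsto (fun N : ℕ => ‖b‖ * q ^ (N + 1)) atTop (𝓝 (‖b‖ * 0)) :=
        (((tendsto_pow_atTop_nhds_zero_of_lt_one hq0 hq1).comp (tendsto_add_atTop_nat 1))).const_mul _
      exact (this.eventually_lt_const (by simpa using hε)).mono fun _ h => h.le
    have h2 : ∀ᶠ N : ℕ in atTop, ‖b‖ * (((N : ℝ) + 1) * q ^ N * C) ≤ ε / 2 := by
      have : Tendsto (fun N : ℕ => ‖b‖ * (((N : ℝ) * q ^ N + q ^ N) * C)) atTop
          (𝓝 (‖b‖ * ((0 + 0) * C))) :=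
        (((tendsto_self_mul_const_pow_of_lt_one hq0 hq1).add
          (tendsto_pow_atTop_nhds_zero_of_lt_one hq0 hq1)).mul_const C).const_mul _
      refine (this.eventually_lt_const (u := ε / 2) (by simpa using hε)).mono fun N h => ?_
      rw [add_one_mul]
      exact h.le
    have h3 : ∀ᶠ N : ℕ in atTop, ∀ v ∈ s, ‖b‖ * ‖p v‖ ^ (N + 1) ≤ 1 := by
      refine (Finset.eventually_all s).2 fun v hv => ?_
      have hv1 := hp1 v (hmax v hv) (fun h => has (h ▸ hv))
      have : Tendsto (fun N : ℕ => ‖b‖ * ‖p v‖ ^ (N + 1)) atTop (𝓝 (‖b‖ * 0)) :=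
        (((tendsto_pow_atTop_nhds_zero_of_lt_one (norm_nonneg _) hv1).comp
          (tendsto_add_atTop_nat 1))).const_mul _
      exact (this.eventually_lt_const (by simp)).mono fun _ h => h.le
    obtain ⟨N, hN1, hN2, hN3⟩ := (h1.and (h2.and h3)).exists
    have hd : Differentiable ℂ fun z => b * p z ^ (N + 1) := (hp.pow _).const_mul b
    refine ⟨fun z => g z + b * p z ^ (N + 1), hg.add hd, fun z hz => ⟨?_, ?_⟩, fun v hv => ?_⟩
    · refine (norm_add_le _ _).trans ?_
      have : ‖b * p z ^ (N + 1)‖ ≤ ‖b‖ * q ^ (N + 1) := by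
        rw [norm_mul, norm_pow]
        gcongr
        exact hpq z hz
      linarith [(hsmall z hz).1]
    · have hder : fderiv ℂ (fun z => b * p z ^ (N + 1)) z =
          b • (((N + 1 : ℕ) * p z ^ N) • fderiv ℂ p z) := by
        have := ((hp z).hasFDerivAt.pow (N + 1)).const_mul b
        simpa using this.fderiv
      rw [fderiv_fun_add (hg z) (hd z), hder]
      refine (norm_add_le _ _).trans ?_
      have : ‖b • (((N + 1 : ℕ) * p z ^ N) • fderiv ℂ p z)‖ ≤
          ‖b‖ * (((N : ℝ) + 1) * q ^ N * C) := by
        rw [norm_smul, norm_smul, norm_mul, norm_pow, Complex.norm_natCast]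
        push_cast
        gcongr
        exacts [hpq z hz, hC z]
      linarith [(hsmall z hz).2]
    · rcases mem_insert.1 hv with rfl | hv
      · simpa [hpa, add_assoc] using hb
      · have h := hN3 v hv
        have h' := hlarge v hv
        rw [← norm_pow, ← norm_mul] at h
        have := norm_sub_le (S v + g v + b * p v ^ (N + 1)) (b * p v ^ (N + 1))
        rw [add_sub_cancel_right] at this
        rw [← add_assoc]
        linarith

open Finset Filter Topology in
/-- On a subset of a complex inner product space which meets every ball in a finite set and does
not contain the origin, some entire function grows as fast as prescribed. -/
theorem exists_entire_large_on_discrete {E : Type*} [NormedAddCommGroup E]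
    [InnerProductSpace ℂ E] (V : Set E) (h0 : (0 : E) ∉ V)
    (hV : ∀ c : ℝ, {v ∈ V | ‖v‖ ≤ c}.Finite) (M : E → ℝ) :
    ∃ f : E → ℂ, Differentiable ℂ f ∧ ∀ v ∈ V, M v ≤ ‖f v‖ := by
  classical
  have hfin : ∀ m : ℕ, {v ∈ V | (m : ℝ) < ‖v‖ ∧ ‖v‖ ≤ m + 1}.Finite := fun m =>
    (hV (m + 1)).subset fun v hv => ⟨hv.1, hv.2.2⟩
  -- Each step corrects the partial sum `S` on the shell `m < ‖v‖ ≤ m + 1`. The margin `2` pays for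
  -- all later terms; the derivative bounds allow termwise differentiation.
  have hstep : ∀ (m : ℕ) (S : E → ℂ), ∃ g : E → ℂ, Differentiable ℂ g ∧
      (∀ z, ‖z‖ ≤ m → ‖g z‖ ≤ (1 / 2 : ℝ) ^ m ∧ ‖fderiv ℂ g z‖ ≤ (1 / 2 : ℝ) ^ m) ∧
      ∀ v ∈ V, (m : ℝ) < ‖v‖ → ‖v‖ ≤ m + 1 → M v + 2 ≤ ‖S v + g v‖ := by
    intro m S
    obtain ⟨g, h1, h2, h3⟩ := exists_small_on_ball_large_on_finset (Nat.cast_nonneg m) S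
      (hfin m).toFinset (fun v hv => by exact ((hfin m).mem_toFinset.1 hv).2.1) (fun v => M v + 2)
      (ε := (1 / 2 : ℝ) ^ m) (by positivity)
    exact ⟨g, h1, h2, fun v hv hv1 hv2 => h3 v (by simp [hv, hv1, hv2])⟩
  choose G hG hGsmall hGlarge using hstep
  let S : ℕ → E → ℂ := fun m => Nat.rec (fun _ => 0) (fun k s z => s z + G k s z) m
  let g : ℕ → E → ℂ := fun m => G m (S m)
  have hS : ∀ m z, S m z = ∑ i ∈ range m, g i z := by
    intro m z
    induction m with
    | zero => simp [S]
    | succ m ih => rw [sum_range_succ, ← ih]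
  have hu : ∀ m : ℕ, Summable fun i => (1 / 2 : ℝ) ^ (i + m) := fun m =>
    (summable_nat_add_iff m).2 summable_geometric_two
  have hbound : ∀ (m : ℕ) z, ‖z‖ ≤ m → ∀ i,
      ‖g (i + m) z‖ ≤ (1 / 2 : ℝ) ^ (i + m) ∧ ‖fderiv ℂ (g (i + m)) z‖ ≤ (1 / 2 : ℝ) ^ (i + m) :=
    fun m z hz i => hGsmall (i + m) _ z (hz.trans (by push_cast; linarith [i.cast_nonneg (α := ℝ)]))
  have htail : ∀ (m : ℕ) z, ‖z‖ ≤ m → Summable fun i => g (i + m) z := fun m z hz =>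
    .of_norm_bounded (hu m) fun i => (hbound m z hz i).1
  have hsum : ∀ z, Summable fun i => g i z := fun z => by
    obtain ⟨m, hm⟩ := exists_nat_ge ‖z‖
    exact (summable_nat_add_iff m).1 (htail m z hm)
  refine ⟨fun z => ∑' i, g i z, fun z => ?_, fun v hv => ?_⟩
  · obtain ⟨m, hm⟩ := exists_nat_gt ‖z‖
    have heq : (fun z => ∑' i, g i z) =
        fun z => ∑ i ∈ range m, g i z + ∑' i, g (i + m) z :=
      funext fun z => ((hsum z).sum_add_tsum_nat_add m).symm
    rw [heq]
    refine .add (.fun_sum fun i _ => hG i _ z) ?_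
    let : NormedSpace ℝ E := NormedSpace.restrictScalars ℝ ℂ E
    refine (hasFDerivAt_tsum_of_isPreconnected (hu m) (s := Metric.ball (0 : E) m) (x₀ := z)
      (f' := fun i => fderiv ℂ (g (i + m)))
      Metric.isOpen_ball (convex_ball _ _).isPreconnected (fun i y _ => (hG _ _ y).hasFDerivAt)
      (fun i y hy => (hbound m y (by simpa using (mem_ball_zero_iff.1 hy).le) i).2)
      (by simpa using hm) (htail m z hm.le) (by simpa using hm)).differentiableAt
  · have hpos : 0 < ‖v‖ := norm_pos_iff.2 fun h => h0 (h ▸ hv)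
    obtain ⟨m, hm1, hm2⟩ : ∃ m : ℕ, (m : ℝ) < ‖v‖ ∧ ‖v‖ ≤ m + 1 := by
      have hc : 0 < ⌈‖v‖⌉₊ := Nat.ceil_pos.2 hpos
      obtain ⟨m, hm⟩ := Nat.exists_eq_add_of_lt hc
      refine ⟨m, Nat.lt_ceil.1 (by omega), (Nat.le_ceil _).trans ?_⟩
      rw [hm]; push_cast; linarith
    have h1 : M v + 2 ≤ ‖S (m + 1) v‖ := hGlarge m (S m) v hv hm1 hm2
    have h2 : ‖∑' i, g (i + (m + 1)) v‖ ≤ 2 := by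
      refine tsum_of_norm_bounded (g := fun i : ℕ => (1 / 2 : ℝ) ^ i) hasSum_geometric_two fun i => ?_
      refine ((hbound (m + 1) v (by push_cast; exact hm2) i).1).trans ?_
      exact pow_le_pow_of_le_one (by norm_num) (by norm_num) (by omega)
    have h3 := (hsum v).sum_add_tsum_nat_add (m + 1)
    rw [← hS] at h3
    change M v ≤ ‖∑' i, g i v‖
    rw [← h3]
    have := norm_sub_le (S (m + 1) v + ∑' i, g (i + (m + 1)) v) (∑' i, g (i + (m + 1)) v)
    rw [add_sub_cancel_right] at this
    linarith

/-! ### Column shears -/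

/-- The `k`-th column of a matrix in `SL n ℂ`, as a vector of a Euclidean space. -/
def column {n : ℕ} (k : Fin n) (A : Matrix.SpecialLinearGroup (Fin n) ℂ) :
    EuclideanSpace ℂ (Fin n) :=
  WithLp.toLp 2 fun i => A.1 i k

open Matrix in
/-- The column operation adding to the `j`-th column a multiple, by a function of the `k`-th
column, of the `k`-th column. -/
def columnShear {n : ℕ} {k j : Fin n} (hkj : k ≠ j) (f : EuclideanSpace ℂ (Fin n) → ℂ)
    (A : SpecialLinearGroup (Fin n) ℂ) : SpecialLinearGroup (Fin n) ℂ :=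
  ⟨A.1 * transvection k j (f (column k A)), by
    rw [det_mul, det_transvection_of_ne _ _ hkj, A.2, mul_one]⟩

open Matrix in
theorem columnShear_column {n : ℕ} {k j : Fin n} (hkj : k ≠ j)
    (f : EuclideanSpace ℂ (Fin n) → ℂ) (A : SpecialLinearGroup (Fin n) ℂ) :
    column k (columnShear hkj f A) = column k A :=
  PiLp.ext fun _ => mul_transvection_apply_of_ne _ _ _ _ hkj _ _

open Matrix in
theorem columnShear_columnShear {n : ℕ} {k j : Fin n} (hkj : k ≠ j)
    (f g : EuclideanSpace ℂ (Fin n) → ℂ) (hfg : ∀ v, f v + g v = 0)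
    (A : SpecialLinearGroup (Fin n) ℂ) : columnShear hkj g (columnShear hkj f A) = A := by
  apply Subtype.ext
  change A.1 * transvection k j _ * transvection k j (g (column k (columnShear hkj f A))) = A.1
  rw [columnShear_column]
  rw [Matrix.mul_assoc, transvection_mul_transvection_same _ _ hkj, hfg, transvection_zero,
    Matrix.mul_one]

attribute [local instance] Matrix.normedAddCommGroup Matrix.normedSpace in
open Matrix in
theorem differentiable_mul_transvection_column {n : ℕ} (k j : Fin n)
    {f : EuclideanSpace ℂ (Fin n) → ℂ} (hf : Differentiable ℂ f) :
    Differentiable ℂ fun B : Matrix (Fin n) (Fin n) ℂ =>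
      B * transvection k j (f (WithLp.toLp 2 fun i => B i k)) := by
  have hent : ∀ a b, Differentiable ℂ fun B : Matrix (Fin n) (Fin n) ℂ => B a b := fun a b =>
    differentiable_pi.1 (differentiable_pi.1 (differentiable_id (E := Matrix (Fin n) (Fin n) ℂ)) a) b
  have hcol : Differentiable ℂ fun B : Matrix (Fin n) (Fin n) ℂ =>
      (WithLp.toLp 2 fun i => B i k : EuclideanSpace ℂ (Fin n)) :=
    (differentiable_euclidean).2 fun i => hent i k
  refine differentiable_pi.2 fun a => differentiable_pi.2 fun b => ?_
  by_cases hb : b = j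
  · subst hb
    simp only [mul_transvection_apply_same]
    exact (hent a b).add ((hf.comp hcol).mul (hent a k))
  · simp only [mul_transvection_apply_of_ne _ _ _ _ hb]
    exact hent a b

theorem isHolomorphicSL_columnShear {n : ℕ} {k j : Fin n} (hkj : k ≠ j)
    {f : EuclideanSpace ℂ (Fin n) → ℂ} (hf : Differentiable ℂ f) :
    IsHolomorphicSL (columnShear hkj f) := fun _ =>
  ⟨Set.univ, _, isOpen_univ, trivial,
    (differentiable_mul_transvection_column k j hf).differentiableOn, fun _ _ => rfl⟩

open Matrix in
/-- A shear as a bijection, whose inverse is the shear by the negative of the function. -/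
def columnShearEquiv {n : ℕ} {k j : Fin n} (hkj : k ≠ j) (f : EuclideanSpace ℂ (Fin n) → ℂ) :
    SpecialLinearGroup (Fin n) ℂ ≃ SpecialLinearGroup (Fin n) ℂ where
  toFun := columnShear hkj f
  invFun := columnShear hkj fun v => -f v
  left_inv := columnShear_columnShear hkj _ _ fun v => add_neg_cancel (f v)
  right_inv := columnShear_columnShear hkj _ _ fun v => neg_add_cancel (f v)

theorem isHolomorphicAut_columnShearEquiv {n : ℕ} {k j : Fin n} (hkj : k ≠ j)
    {f : EuclideanSpace ℂ (Fin n) → ℂ} (hf : Differentiable ℂ f) :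
    IsHolomorphicAut (columnShearEquiv hkj f) :=
  ⟨isHolomorphicSL_columnShear hkj hf,
    isHolomorphicSL_columnShear hkj (f := fun v => -f v) hf.fun_neg⟩

/-- A subset of a discrete subset is discrete. -/
theorem IsDiscreteSubset.mono {X : Type*} [TopologicalSpace X] {D T : Set X}
    (hD : IsDiscreteSubset D) (hT : T ⊆ D) : IsDiscreteSubset T := by
  refine ⟨?_, hD.2.mono hT⟩
  have := hD.2.to_subtype
  have h := hD.1.isClosedEmbedding_subtypeVal.isClosedMap (Subtype.val ⁻¹' T)
    (isClosed_discrete _)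
  rwa [Subtype.image_preimage_coe, Set.inter_eq_right.2 hT] at h

open Matrix in
theorem exists_column_entry_ne_zero {n : ℕ} (A : SpecialLinearGroup (Fin n) ℂ) (k : Fin n) :
    ∃ i, A.1 i k ≠ 0 := by
  by_contra! h
  exact one_ne_zero (A.2.symm.trans (det_eq_zero_of_column_eq_zero k h))

open Matrix in
/-- A shear by a sufficiently large function moves a given point out of a given sublevel set of an
exhaustion function. -/
theorem exists_le_columnShear_of_le_norm {n : ℕ} {k j : Fin n} (hkj : k ≠ j)
    {ρ : SpecialLinearGroup (Fin n) ℂ → ℝ} (hρ : IsExhaustion ρ)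
    (A : SpecialLinearGroup (Fin n) ℂ) (c : ℝ) :
    ∃ M : ℝ, ∀ f : EuclideanSpace ℂ (Fin n) → ℂ, M ≤ ‖f (column k A)‖ →
      c ≤ ρ (columnShear hkj f A) := by
  obtain ⟨i, hi⟩ := exists_column_entry_ne_zero A k
  have hcont : Continuous fun B : SpecialLinearGroup (Fin n) ℂ => B.1 i j :=
    continuous_subtype_val.matrix_elem i j
  obtain ⟨R, hR⟩ := (hρ.2.2 c).exists_bound_of_continuousOn hcont.continuousOn
  -- `R` bounds the `(i, j)` entry on the sublevel set, and this `M` pushes that entry of the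
  -- sheared matrix beyond `R`.
  refine ⟨(R + ‖A.1 i j‖ + 1) / ‖A.1 i k‖, fun f hf => ?_⟩
  by_contra! hlt
  have hR' := hR (columnShear hkj f A) hlt.le
  have hval : (columnShear hkj f A).1 i j =
      A.1 i j + f (column k A) * A.1 i k :=
    mul_transvection_apply_same _ _ _ _ _
  rw [hval] at hR'
  rw [div_le_iff₀ (norm_pos_iff.2 hi), ← norm_mul] at hf
  have := norm_sub_le (A.1 i j + f (column k A) * A.1 i k) (A.1 i j)
  rw [add_sub_cancel_left] at this
  linarith

open Matrix in
/-- If the norm of the `k`-th column is a proper function on an infinite discrete subset of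
`SL n ℂ`, then this subset is tame. -/
theorem isTame_of_finite_columnNorm_le {n : ℕ} (k : Fin n)
    {T : Set (SpecialLinearGroup (Fin n) ℂ)} (hinf : T.Infinite) (hT : IsDiscreteSubset T)
    (hfin : ∀ c : ℝ, {A ∈ T | columnNorm k A ≤ c}.Finite) : IsTame T := by
  refine ⟨hinf, hT, fun ρ hρ ζ _ => ?_⟩
  -- A second column is needed to receive the shear.
  have hn : Nontrivial (Fin n) := by
    by_contra h
    rw [not_nontrivial_iff_subsingleton] at h
    have : Subsingleton (SpecialLinearGroup (Fin n) ℂ) := inferInstance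
    exact hinf (Set.toFinite T)
  obtain ⟨j, hjk⟩ := exists_ne k
  choose M hM using fun A : T => exists_le_columnShear_of_le_norm hjk.symm hρ A.1 (ζ A)
  -- `f` sees only column `k`, so one bound must serve all points sharing it.
  have hfibre : ∀ v, ∃ b : ℝ, ∀ A : T, column k A = v → M A ≤ b := by
    intro v
    have h : {A : T | column k A = v}.Finite := by
      refine Set.Finite.of_finite_image ((hfin ‖v‖).subset ?_) Subtype.val_injective.injOn
      rintro _ ⟨A, rfl, rfl⟩
      exact ⟨A.2, le_rfl⟩
    obtain ⟨b, hb⟩ := (h.image M).bddAbove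
    exact ⟨b, fun A hA => hb ⟨A, hA, rfl⟩⟩
  choose b hb using hfibre
  obtain ⟨f, hf, hfb⟩ := exists_entire_large_on_discrete (column k '' T)
    (by
      rintro ⟨A, _, hA⟩
      obtain ⟨i, hi⟩ := exists_column_entry_ne_zero A k
      exact hi (congrArg (fun v : EuclideanSpace ℂ (Fin n) => v i) hA))
    (fun c => ((hfin c).image (column k)).subset (by
      rintro _ ⟨⟨A, hA, rfl⟩, hc⟩
      exact ⟨A, ⟨hA, hc⟩, rfl⟩)) b
  refine ⟨columnShearEquiv hjk.symm f, isHolomorphicAut_columnShearEquiv hjk.symm hf, fun A => ?_⟩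
  exact hM A f ((hb _ A rfl).trans (hfb _ ⟨A, A.2, rfl⟩))

/-! ### Pieces with a dominant column -/

open Matrix in
theorem isCompact_setOf_columnNorm_le (n : ℕ) (c : ℝ) :
    IsCompact {A : SpecialLinearGroup (Fin n) ℂ | ∀ j, columnNorm j A ≤ c} := by
  have hK : IsCompact {B : Matrix (Fin n) (Fin n) ℂ | ∀ i, B i ∈ {r : Fin n → ℂ | ∀ j, r j ∈
      Metric.closedBall (0 : ℂ) c}} :=
    isCompact_pi_infinite fun _ => isCompact_pi_infinite fun _ => isCompact_closedBall _ _
  refine (SpecialLinearGroup.isClosedEmbedding_val.isCompact_preimage hK).of_isClosed_subset ?_ ?_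
  · simp only [Set.ofPred_forall]
    refine isClosed_iInter fun j => isClosed_le ?_ continuous_const
    refine ((PiLp.continuous_toLp 2 _).comp (continuous_pi fun i => ?_)).norm
    fun_prop
  · intro A hA i j
    rw [mem_closedBall_zero_iff]
    exact (PiLp.norm_apply_le (WithLp.toLp 2 fun i => A.1 i j : EuclideanSpace ℂ (Fin n)) i).trans
      (hA j)

/-- On the piece a bound on column `k` bounds every column, and a closed discrete set meets a
compact set in finitely many points. -/
theorem finite_columnPiece_columnNorm_le {n : ℕ}
    {D : Set (Matrix.SpecialLinearGroup (Fin n) ℂ)} (hD : IsDiscreteSubset D) (k : Fin n) (c : ℝ) :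
    {A ∈ columnPiece D k | columnNorm k A ≤ c}.Finite :=
  (((isCompact_setOf_columnNorm_le n c).inter_left hD.1).finite
    (hD.2.mono Set.inter_subset_left)).subset
    fun _ hA => ⟨hA.1.1, fun j => (hA.1.2 j).trans hA.2⟩

theorem iUnion_columnPiece {n : ℕ} [Nonempty (Fin n)]
    (D : Set (Matrix.SpecialLinearGroup (Fin n) ℂ)) : ⋃ k, columnPiece D k = D := by
  refine Set.Subset.antisymm (Set.iUnion_subset fun k A hA => hA.1) fun A hA => ?_
  obtain ⟨k, hk⟩ := Finite.exists_max fun j => columnNorm j A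
  exact Set.mem_iUnion.2 ⟨k, hA, hk⟩

theorem mainTheorem5 (n : ℕ) (D : Set (Matrix.SpecialLinearGroup (Fin n) ℂ))
    (hD : IsDiscreteSubset D) (hinf : D.Infinite) :
    ∃ T : Fin n → Set (Matrix.SpecialLinearGroup (Fin n) ℂ),
      (∀ k, IsTame (T k)) ∧ (⋃ k, T k) = D ∧
        ∀ k, columnPiece D k ⊆ T k ∧ ((columnPiece D k).Infinite → T k = columnPiece D k) := by
  classical
  have hne : Nonempty (Fin n) := by
    by_contra h
    rw [not_nonempty_iff] at h
    exact hinf (Set.toFinite D)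
  have hsub : ∀ k, columnPiece D k ⊆ D := fun k A hA => hA.1
  obtain ⟨m, hm⟩ : ∃ m, (columnPiece D m).Infinite := by
    by_contra! h
    rw [← iUnion_columnPiece D] at hinf
    exact hinf (Set.finite_iUnion h)
  let T : Fin n → Set (Matrix.SpecialLinearGroup (Fin n) ℂ) := fun k =>
    if (columnPiece D k).Infinite then columnPiece D k else columnPiece D k ∪ columnPiece D m
  have hT : ∀ k, columnPiece D k ⊆ T k := fun k => by
    by_cases h : (columnPiece D k).Infinite <;> simp [T, h]
  have hTD : ∀ k, T k ⊆ D := fun k => by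
    by_cases h : (columnPiece D k).Infinite <;> simp [T, h, hsub]
  refine ⟨T, fun k => ?_, ?_, fun k => ⟨hT k, fun h => if_pos h⟩⟩
  · by_cases h : (columnPiece D k).Infinite
    · simp only [T, if_pos h]
      exact isTame_of_finite_columnNorm_le k h (hD.mono (hsub k))
        (finite_columnPiece_columnNorm_le hD k)
    -- A padded piece is sheared along column `m`; its finitely many extra points do not affect
    -- properness.
    · refine isTame_of_finite_columnNorm_le m ?_ (hD.mono (hTD k)) fun c => ?_
      · simp only [T, if_neg h]
        exact hm.mono Set.subset_union_right
      · simp only [T, if_neg h]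
        refine ((Set.not_infinite.1 h).union (finite_columnPiece_columnNorm_le hD m c)).subset ?_
        rintro A ⟨hA | hA, hc⟩
        exacts [.inl hA, .inr ⟨hA, hc⟩]
  · refine Set.Subset.antisymm (Set.iUnion_subset hTD) ?_
    conv_lhs => rw [← iUnion_columnPiece D]
    exact Set.iUnion_mono hT
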